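/- Let $p\ge 5$ be an integer. Let $m_0=1$, $m_1=p-2$, $m_{n+2}=(p-2)m_{n+1}-m_n$, and write $\mathbf d=p-3$, $\mathbf c=p-4$ for the corresponding digits. The metallic code $[n]$ of a positive integer $n$ is the unique word $\mathbf a_k\ldots\mathbf a_1\mathbf a_0$ with digits in $\{0,\ldots,p-3\}$ and $\mathbf a_k\neq 0$ such that $n=\sum_{i=0}^k a_im_i$ and no factor of the word has the form $\mathbf d\mathbf c^j\mathbf d$ with $j\ge 0$; the signature of $n$ is its last digit $\mathbf a_0$. The black metallic tree $\mathcal B$ is the infinite tree whose nodes are black ($\mathbf b$) or white ($\mathbf w$), whose root is black, and in which a black node has $p-3$ sons and a white node has $p-2$ sons, exactly one of the sons of each node being black. Its nodes are numbered $1,2,3,\ldots$ from the root on, level by level and from left to right, and are identified with their numbers. An assignment on $\mathcal B$ is a choice, for each node, of the position of the black one among its sons. The rightmost assignment $\rho$ makes the last son of every node the black one; $\mathcal B_\rho$ is $\mathcal B$ equipped with $\rho$. A node is said to be of type $\mathbf{ba}$ or $\mathbf{wa}$ if it is black, respectively white, and has signature $\mathbf a$. An assignment has the preferred son property if every node $\nu$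 has exactly one son with signature $\mathbf 0$ and the metallic code of that son is $[\nu]\mathbf 0$. Then: 1. In $\mathcal B_\rho$ the root is of type $\mathbf{b1}$, and every other node is either of type $\mathbf{b0}$ or of type $\mathbf{wa}$ with $1\le \mathbf a\le \mathbf d$. The types of the sons, from left to right, are given by $$\mathbf{b0}\to \mathbf{w1}\ldots\mathbf{wc}\,\mathbf{b0},\qquad \mathbf{wa}\to\mathbf{w1}\ldots\mathbf{wd}\,\mathbf{b0}\quad(\mathbf a>\mathbf 0),$$ and, for the root only, by $\mathbf{b1}\to\mathbf{w2}\ldots\mathbf{wd}\,\mathbf{b0}$. 2. In $\mathcal B_\rho$, if $\nu\ne1$ is black, its $h$-th son has the metallic code $[\nu-1]\mathbf h$ for $1\le h\le p-4$, and its last, $(p-3)$-th, son has the metallic code $[\nu]\mathbf 0$. If $\nu$ is white, its $h$-th son has the metallic code $[\nu-1]\mathbf h$ for $1\le h\le p-3$, and its last, $(p-2)$-th, son has the metallic code $[\nu]\mathbf 0$. The sons of the root have the metallic codes $\mathbf 2,\ldots,\mathbf d,\mathbf{10}$. 3. $\rho$ has the preferred son property, and for no other assignment on $\mathcal B$ is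 it true that every node $\nu$ has exactly one son with metallic code $[\nu]\mathbf 0$; in particular no other assignment has the preferred son property. -/

import Mathlib

namespace MetallicTree

/-! ### Metallic numbers and metallic codes -/

/-- The metallic numbers `m₀ = 1`, `m₁ = p - 2`, `mₙ₊₂ = (p - 2) mₙ₊₁ - mₙ`. For `5 ≤ p` the
sequence increases, so that the subtraction never truncates (see `metallicNumber_add`). -/
def metallicNumber (p : ℕ) : ℕ → ℕ
  | 0 => 1
  | 1 => p - 2
  | n + 2 => (p - 2) * metallicNumber p (n + 1) - metallicNumber p n

/-- Words of digits are written with the least significant digit at the head: the list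
`[a₀, a₁, …, aₖ]` is the word `aₖ…a₁a₀`. Its value is `∑ aᵢ mᵢ`. -/
def wordValue (p : ℕ) (w : List ℕ) : ℕ :=
  ∑ i : Fin w.length, w.get i * metallicNumber p i

/-- The word contains a factor `d c … c d` (possibly without any `c`), with the digits
`d = p - 3` and `c = p - 4`. -/
def HasForbiddenPattern (p : ℕ) (w : List ℕ) : Prop :=
  ∃ j : ℕ, ((p - 3) :: (List.replicate j (p - 4) ++ [p - 3])) <:+: w

/-- The word `w` is a metallic code of `n`: its digits lie in `{0, …, p - 3}`, its leading digit is
not `0`, it avoids the forbidden pattern, and it represents `n`. -/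
structure IsMetallicCode (p : ℕ) (w : List ℕ) (n : ℕ) : Prop where
  digit_le : ∀ a ∈ w, a ≤ p - 3
  leading_ne_zero : w.getLast? ≠ some 0
  not_forbidden : ¬ HasForbiddenPattern p w
  value_eq : wordValue p w = n

open Classical in
/-- The metallic code `[n]` of `n`, least significant digit first. For `5 ≤ p` it exists and is
unique, see `isMetallicCode_iff`. -/
noncomputable def metallicCode (p n : ℕ) : List ℕ :=
  if h : ∃ w, IsMetallicCode p w n then h.choose else []

/-- The signature of `n`: the rightmost (least significant) digit of `[n]`. -/
noncomputable def signature (p n : ℕ) : ℕ := (metallicCode p n).headD 0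

/-! ### Existence and uniqueness of the metallic code -/

/-- `mₖ₋₁`, with `m₋₁ = 0`. -/
def prevNumber (p : ℕ) : ℕ → ℕ
  | 0 => 0
  | k + 1 => metallicNumber p k

theorem prevNumber_lt_and_add {p : ℕ} (hp : 5 ≤ p) (k : ℕ) :
    prevNumber p k < metallicNumber p k ∧
      metallicNumber p (k + 1) + prevNumber p k = (p - 2) * metallicNumber p k := by
  induction k with
  | zero => simp [prevNumber, metallicNumber]
  | succ k ih =>
    obtain ⟨h1, h2⟩ := ih
    have h3 : 3 * metallicNumber p k ≤ (p - 2) * metallicNumber p k :=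
      Nat.mul_le_mul_right _ (by omega)
    have h4 : metallicNumber p k < metallicNumber p (k + 1) := by omega
    refine ⟨h4, ?_⟩
    have h5 : 3 * metallicNumber p (k + 1) ≤ (p - 2) * metallicNumber p (k + 1) :=
      Nat.mul_le_mul_right _ (by omega)
    simp only [metallicNumber, prevNumber] at *
    omega

/-- The recurrence without subtraction. -/
theorem metallicNumber_add {p : ℕ} (hp : 5 ≤ p) (n : ℕ) :
    metallicNumber p (n + 2) + metallicNumber p n = (p - 2) * metallicNumber p (n + 1) :=
  (prevNumber_lt_and_add hp (n + 1)).2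

theorem metallicNumber_strictMono {p : ℕ} (hp : 5 ≤ p) : StrictMono (metallicNumber p) :=
  strictMono_nat_of_lt_succ fun n => (prevNumber_lt_and_add hp (n + 1)).1

theorem wordValue_concat (p : ℕ) (w : List ℕ) (a : ℕ) :
    wordValue p (w ++ [a]) = wordValue p w + a * metallicNumber p w.length := by
  have key : ∀ u : List ℕ,
      wordValue p u = ∑ i ∈ Finset.range u.length, u.getD i 0 * metallicNumber p i := by
    intro u
    rw [wordValue, Finset.sum_range]
    refine Finset.sum_congr rfl fun i _ => ?_
    simp
  rw [key, key, List.length_append, List.length_singleton, Finset.sum_range_succ]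
  congr 1
  · refine Finset.sum_congr rfl fun i hi => ?_
    rw [Finset.mem_range] at hi
    simp [List.getD_eq_getElem?_getD, List.getElem?_append_left hi]
  · simp [List.getD_eq_getElem?_getD]

/-- Words with admissible digits that avoid the forbidden pattern; leading zeros are allowed. -/
def IsAdmissible (p : ℕ) (w : List ℕ) : Prop :=
  (∀ a ∈ w, a ≤ p - 3) ∧ ¬ HasForbiddenPattern p w

/-- The word does not begin (at its most significant end) with `c … c d`. -/
def IsLow (p : ℕ) (w : List ℕ) : Prop :=
  ∀ j : ℕ, ¬ ((p - 3) :: List.replicate j (p - 4)) <:+ w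

theorem isAdmissible_concat {p : ℕ} (w : List ℕ) (a : ℕ) :
    IsAdmissible p (w ++ [a]) ↔
      IsAdmissible p w ∧ a ≤ p - 3 ∧ (a = p - 3 → IsLow p w) := by
  have h : HasForbiddenPattern p (w ++ [a]) ↔
      HasForbiddenPattern p w ∨ (a = p - 3 ∧ ¬ IsLow p w) := by
    simp only [HasForbiddenPattern, IsLow, List.infix_concat_iff, exists_or, not_forall, not_not]
    rw [or_comm]
    refine or_congr Iff.rfl ⟨?_, ?_⟩
    · rintro ⟨j, hj⟩
      rw [← List.cons_append, List.suffix_concat_iff] at hj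
      rcases hj with hj | ⟨t, ht, hs⟩
      · simp at hj
      · obtain ⟨rfl, h2⟩ := List.append_inj' ht rfl
        simp only [List.cons.injEq, and_true] at h2
        exact ⟨h2.symm, j, hs⟩
    · rintro ⟨rfl, j, hj⟩
      refine ⟨j, ?_⟩
      rw [← List.cons_append, List.suffix_concat_iff]
      exact Or.inr ⟨_, rfl, hj⟩
  unfold IsAdmissible
  rw [h]
  simp only [List.mem_append, List.mem_singleton]
  constructor
  · rintro ⟨h1, h2⟩
    push Not at h2
    exact ⟨⟨fun b hb => h1 b (Or.inl hb), h2.1⟩, h1 a (Or.inr rfl), h2.2⟩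
  · rintro ⟨⟨h1, h2⟩, h3, h4⟩
    refine ⟨?_, ?_⟩
    · rintro b (hb | rfl)
      · exact h1 b hb
      · exact h3
    · rintro (h5 | ⟨h5, h6⟩)
      · exact h2 h5
      · exact h6 (h4 h5)

theorem isLow_concat {p : ℕ} (hp : 5 ≤ p) (w : List ℕ) (a : ℕ) :
    IsLow p (w ++ [a]) ↔ a ≠ p - 3 ∧ (a = p - 4 → IsLow p w) := by
  simp only [IsLow]
  constructor
  · intro h
    refine ⟨?_, ?_⟩
    · rintro rfl
      exact h 0 ⟨w, by simp⟩
    · rintro rfl j ⟨t, ht⟩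
      refine h (j + 1) ⟨t, ?_⟩
      rw [List.replicate_succ', ← List.cons_append, ← List.append_assoc, ht]
  · rintro ⟨h1, h2⟩ j hj
    cases j with
    | zero =>
      obtain ⟨t, ht⟩ := hj
      have := List.append_inj' ht rfl
      simp at this
      omega
    | succ j =>
      rw [List.replicate_succ', ← List.cons_append, List.suffix_concat_iff] at hj
      rcases hj with hj | ⟨t, ht, hs⟩
      · simp at hj
      · obtain ⟨rfl, h3⟩ := List.append_inj' ht rfl
        simp only [List.cons.injEq, and_true] at h3
        exact h2 h3.symm j hs

theorem wordValue_lt {p : ℕ} (hp : 5 ≤ p) (w : List ℕ) (hw : IsAdmissible p w) :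
    wordValue p w < metallicNumber p w.length ∧
      (IsLow p w → wordValue p w + prevNumber p w.length < metallicNumber p w.length) := by
  induction w using List.reverseRecOn with
  | nil => simp [wordValue, metallicNumber, prevNumber]
  | append_singleton w a ih =>
    rw [isAdmissible_concat] at hw
    obtain ⟨h1, h2, h3⟩ := hw
    obtain ⟨i1, i2⟩ := ih h1
    rw [wordValue_concat, isLow_concat hp, List.length_append, List.length_singleton]
    obtain ⟨r1, r2⟩ := prevNumber_lt_and_add hp w.length
    change _ ∧ (_ → _ + metallicNumber p w.length < _)
    generalize metallicNumber p w.length = m at *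
    obtain ⟨q, rfl⟩ : ∃ q, p = q + 5 := ⟨p - 5, by omega⟩
    simp only [show q + 5 - 2 = q + 3 by omega, show q + 5 - 3 = q + 2 by omega,
      show q + 5 - 4 = q + 1 by omega] at *
    constructor
    · rcases h2.lt_or_eq with h | h
      · have := Nat.mul_le_mul_right m (show a ≤ q + 1 by omega)
        nlinarith
      · have := i2 (h3 h)
        subst h
        nlinarith
    · rintro ⟨h4, h5⟩
      by_cases h : a = q + 1
      · have := i2 (h5 h)
        subst h
        nlinarith
      · have := Nat.mul_le_mul_right m (show a ≤ q by omega)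
        nlinarith

theorem eq_of_wordValue_eq {p : ℕ} (hp : 5 ≤ p) (w v : List ℕ) (hw : IsAdmissible p w)
    (hv : IsAdmissible p v) (hl : w.length = v.length) (h : wordValue p w = wordValue p v) :
    w = v := by
  induction w using List.reverseRecOn generalizing v with
  | nil => exact (List.length_eq_zero_iff.1 hl.symm).symm
  | append_singleton w a ih =>
    rcases List.eq_nil_or_concat' v with rfl | ⟨u, b, rfl⟩
    · simp at hl
    · rw [isAdmissible_concat] at hw hv
      have hl' : w.length = u.length := by simpa using hl
      have e1 := (wordValue_lt hp w hw.1).1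
      have e2 := (wordValue_lt hp u hv.1).1
      rw [wordValue_concat, wordValue_concat] at h
      rw [hl'] at h e1
      have hab : a = b := by
        have h1 := congrArg (· / metallicNumber p u.length) h
        have h0 : 0 < metallicNumber p u.length := by omega
        simpa [Nat.add_mul_div_right _ _ h0, Nat.div_eq_of_lt e1, Nat.div_eq_of_lt e2] using h1
      subst hab
      rw [ih u hw.1 hv.1 hl' (by omega)]

theorem exists_isAdmissible {p : ℕ} (hp : 5 ≤ p) (k n : ℕ) (hn : n < metallicNumber p k) :
    ∃ w, w.length = k ∧ IsAdmissible p w ∧ wordValue p w = n ∧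
      (n + prevNumber p k < metallicNumber p k → IsLow p w) := by
  induction k generalizing n with
  | zero =>
    refine ⟨[], rfl, ⟨by simp, ?_⟩, ?_, fun _ j hj => ?_⟩
    · rintro ⟨j, hj⟩
      simp at hj
    · simp [metallicNumber] at hn
      simp [wordValue, hn]
    · simp at hj
  | succ k ih =>
    obtain ⟨r1, r2⟩ := prevNumber_lt_and_add hp k
    have hm : 0 < metallicNumber p k := by omega
    have hdiv := Nat.div_add_mod n (metallicNumber p k)
    have hmod := Nat.mod_lt n hm
    obtain ⟨w, w1, w2, w3, w4⟩ := ih (n % metallicNumber p k) hmod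
    have hc : ∀ e, n / metallicNumber p k = e → n = e * metallicNumber p k +
        n % metallicNumber p k := by
      rintro e rfl
      rw [mul_comm]
      exact hdiv.symm
    obtain ⟨q, rfl⟩ : ∃ q, p = q + 5 := ⟨p - 5, by omega⟩
    refine ⟨w ++ [n / metallicNumber (q + 5) k], by simp [w1], ?_, ?_, ?_⟩
    · rw [isAdmissible_concat]
      refine ⟨w2, ?_, fun h => w4 ?_⟩
      · have : n / metallicNumber (q + 5) k < q + 5 - 2 := by
          rw [Nat.div_lt_iff_lt_mul hm]
          omega
        omega
      · have := hc _ h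
        simp only [show q + 5 - 2 = q + 3 by omega, show q + 5 - 3 = q + 2 by omega] at *
        nlinarith
    · rw [wordValue_concat, w1, w3, mul_comm]
      omega
    · change n + metallicNumber _ k < _ → _
      intro h
      rw [isLow_concat hp]
      simp only [show q + 5 - 2 = q + 3 by omega, show q + 5 - 3 = q + 2 by omega,
        show q + 5 - 4 = q + 1 by omega] at *
      refine ⟨fun h' => ?_, fun h' => w4 ?_⟩
      · have := hc _ h'
        nlinarith
      · have := hc _ h'
        nlinarith

/-- Every natural number has exactly one metallic code (the code of `0` being empty). -/
theorem existsUnique_isMetallicCode {p : ℕ} (hp : 5 ≤ p) (n : ℕ) :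
    ∃! w, IsMetallicCode p w n := by
  have strip : ∀ w : List ℕ, IsAdmissible p w →
      ∃ v, IsAdmissible p v ∧ wordValue p v = wordValue p w ∧ v.getLast? ≠ some 0 := by
    intro w
    induction w using List.reverseRecOn with
    | nil => exact fun h => ⟨[], h, rfl, by simp⟩
    | append_singleton w a ih =>
      intro h
      by_cases ha : a = 0
      · subst ha
        obtain ⟨v, h1, h2, h3⟩ := ih ((isAdmissible_concat _ _).1 h).1
        exact ⟨v, h1, by rw [h2, wordValue_concat]; simp, h3⟩
      · exact ⟨_, h, rfl, by simpa using ha⟩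
  have lower : ∀ w : List ℕ, w.getLast? ≠ some 0 → w ≠ [] →
      metallicNumber p (w.length - 1) ≤ wordValue p w := by
    intro w h1 h2
    rcases List.eq_nil_or_concat' w with rfl | ⟨u, b, rfl⟩
    · exact absurd rfl h2
    · have hb : 1 ≤ b := by
        simp at h1
        omega
      rw [wordValue_concat, List.length_append, List.length_singleton, Nat.add_sub_cancel]
      nlinarith
  have key : ∀ w v : List ℕ, IsMetallicCode p w n → IsMetallicCode p v n →
      ¬ w.length < v.length := by
    intro w v hw hv h
    have h1 := (wordValue_lt hp w ⟨hw.digit_le, hw.not_forbidden⟩).1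
    have h2 := lower v hv.leading_ne_zero (by rintro rfl; simp at h)
    have h3 := (metallicNumber_strictMono hp).monotone (show w.length ≤ v.length - 1 by omega)
    rw [hw.value_eq] at h1
    rw [hv.value_eq] at h2
    omega
  have hn : n < metallicNumber p (n + 1) :=
    lt_of_lt_of_le (Nat.lt_succ_self n) ((metallicNumber_strictMono hp).le_apply)
  obtain ⟨w, -, w2, w3, -⟩ := exists_isAdmissible hp (n + 1) n hn
  obtain ⟨v, v1, v2, v3⟩ := strip w w2
  refine ⟨v, ⟨v1.1, v3, v1.2, v2.trans w3⟩, fun u hu => ?_⟩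
  have hv : IsMetallicCode p v n := ⟨v1.1, v3, v1.2, v2.trans w3⟩
  have := key _ _ hu hv
  have := key _ _ hv hu
  exact eq_of_wordValue_eq hp u v ⟨hu.digit_le, hu.not_forbidden⟩ v1 (by omega)
    (hu.value_eq.trans hv.value_eq.symm)

theorem isMetallicCode_iff {p : ℕ} (hp : 5 ≤ p) (w : List ℕ) (n : ℕ) :
    IsMetallicCode p w n ↔ metallicCode p n = w := by
  obtain ⟨v, hv, huniq⟩ := existsUnique_isMetallicCode hp n
  have hex : ∃ w, IsMetallicCode p w n := ⟨v, hv⟩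
  have hcode : IsMetallicCode p (metallicCode p n) n := by
    rw [metallicCode, dif_pos hex]
    exact hex.choose_spec
  constructor
  · intro h
    rw [huniq _ h, huniq _ hcode]
  · rintro rfl
    exact hcode

/-! ### Assignments on the black metallic tree -/

/-- The (literal) status of a node. -/
inductive Status
  | black
  | white

/-- The number of sons of a node: `p - 3` for a black node, `p - 2` for a white one. -/
def numSons (p : ℕ) : Status → ℕ
  | .black => p - 3
  | .white => p - 2

/-- An assignment on the black metallic tree. The nodes are the positive integers, given by the
natural numbering: the root is `1`, and the nodes are numbered level by level, from left to right.
To a node `ν` it associates its status, its leftmost son, and the position (the leftmost being `1`)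
of the unique black node among the sons of `ν`. The root is black; the sons of `ν` are consecutive
nodes, they are followed by the sons of `ν + 1`, and exactly one of them is black. -/
@[ext]
structure BlackAssignment (p : ℕ) where
  leftmost : ℕ+ → ℕ+
  blackPos : ℕ+ → ℕ
  status : ℕ+ → Status
  status_root : status 1 = .black
  leftmost_root : leftmost 1 = 2
  leftmost_succ : ∀ ν, (leftmost (ν + 1) : ℕ) = leftmost ν + numSons p (status ν)
  one_le_blackPos : ∀ ν, 1 ≤ blackPos ν
  blackPos_le : ∀ ν, blackPos ν ≤ numSons p (status ν)
  status_son : ∀ ν σ : ℕ+, (leftmost ν : ℕ) ≤ σ → (σ : ℕ) < leftmost (ν + 1) →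
    (status σ = .black ↔ (σ : ℕ) + 1 = leftmost ν + blackPos ν)

namespace BlackAssignment

variable {p : ℕ}

/-- The sons of the node `ν`, from left to right. -/
def sons (α : BlackAssignment p) (ν : ℕ+) : List ℕ+ :=
  (List.range (numSons p (α.status ν))).map fun i =>
    Nat.toPNat (α.leftmost ν + i) (Nat.add_pos_left (α.leftmost ν).pos i)

/-- The type of a node: its status together with its signature. -/
noncomputable def nodeType (α : BlackAssignment p) (ν : ℕ+) : Status × ℕ :=
  (α.status ν, signature p ν)

/-- Every node has exactly one son whose signature is `a`. -/
def IsDigitAssignment (a : ℕ) (α : BlackAssignment p) : Prop :=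
  ∀ ν : ℕ+, ∃! σ : ℕ+, σ ∈ α.sons ν ∧ signature p σ = a

/-- For every node `ν`, exactly one of its sons has the metallic code `[ν]0`. -/
def HasPreferredSonProperty (α : BlackAssignment p) : Prop :=
  ∀ ν : ℕ+, ∃! σ : ℕ+, σ ∈ α.sons ν ∧ metallicCode p σ = 0 :: metallicCode p ν

end BlackAssignment

/-! ### The rightmost assignment -/

/-- The statuses of the sons of a node of status `s`, from left to right, when the black son is the
rightmost one. -/
def rightmostBlock (p : ℕ) (s : Status) : List Status :=
  List.replicate (numSons p s - 1) .white ++ [.black]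

/-- The statuses of the root and of the sons of the nodes `1, …, n`, in the order of the natural
numbering, when every black son is the rightmost one. -/
def rightmostStatuses (p : ℕ) : ℕ → List Status
  | 0 => [.black]
  | n + 1 => rightmostStatuses p n ++
      rightmostBlock p ((rightmostStatuses p n).getD n .white)

theorem length_rightmostBlock {p : ℕ} (hp : 5 ≤ p) (s : Status) :
    (rightmostBlock p s).length = numSons p s := by
  cases s <;> simp [rightmostBlock, numSons] <;> omega

theorem lt_length_rightmostStatuses (p n : ℕ) : n < (rightmostStatuses p n).length := by
  induction n with
  | zero => simp [rightmostStatuses]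
  | succ n ih => simp [rightmostStatuses, rightmostBlock]; omega

theorem getD_rightmostStatuses {p n m : ℕ} (h : n ≤ m) :
    ∀ i < (rightmostStatuses p n).length,
      (rightmostStatuses p m).getD i .white = (rightmostStatuses p n).getD i .white := by
  induction m, h using Nat.le_induction with
  | base => exact fun _ _ => rfl
  | succ m hm ih =>
    intro i hi
    have hlen : (rightmostStatuses p n).length ≤ (rightmostStatuses p m).length := by
      clear ih
      induction m, hm using Nat.le_induction with
      | base => exact le_rfl
      | succ m _ ih => simp [rightmostStatuses]; omega
    rw [← ih i hi, rightmostStatuses, List.getD_append _ _ _ _ (lt_of_lt_of_le hi hlen)]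

/-- The rightmost assignment: the black son of every node is its rightmost son. -/
def rightmost (p : ℕ) (hp : 5 ≤ p) : BlackAssignment p where
  leftmost ν := Nat.succPNat (rightmostStatuses p (ν - 1)).length
  blackPos ν := numSons p ((rightmostStatuses p (ν - 1)).getD (ν - 1) .white)
  status ν := (rightmostStatuses p (ν - 1)).getD (ν - 1) .white
  status_root := rfl
  leftmost_root := rfl
  leftmost_succ ν := by
    obtain ⟨n, hn⟩ : ∃ n, (ν : ℕ) = n + 1 := ⟨ν - 1, by have := ν.pos; omega⟩
    simp only [Nat.succPNat_coe, Nat.succ_eq_add_one, PNat.add_coe, PNat.one_coe, hn, Nat.add_sub_cancel, rightmostStatuses,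
      List.length_append, length_rightmostBlock hp]
    omega
  one_le_blackPos ν := by
    generalize (rightmostStatuses p (ν - 1)).getD (ν - 1) .white = s
    cases s <;> simp only [numSons] <;> omega
  blackPos_le ν := le_rfl
  status_son ν σ h1 h2 := by
    obtain ⟨n, hn⟩ : ∃ n, (ν : ℕ) = n + 1 := ⟨ν - 1, by have := ν.pos; omega⟩
    obtain ⟨m, hm⟩ : ∃ m, (σ : ℕ) = m + 1 := ⟨σ - 1, by have := σ.pos; omega⟩
    simp only [Nat.succPNat_coe, Nat.succ_eq_add_one, PNat.add_coe, PNat.one_coe, hn, hm, Nat.add_sub_cancel] at h1 h2 ⊢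
    have hlen := lt_length_rightmostStatuses p n
    rw [getD_rightmostStatuses (show n + 1 ≤ m by omega) m (by omega)]
    rw [rightmostStatuses, List.length_append, length_rightmostBlock hp] at h2
    rw [rightmostStatuses, List.getD_append_right _ _ _ _ (by omega)]
    generalize (rightmostStatuses p n).getD n .white = s at *
    obtain ⟨i, hi⟩ : ∃ i, m = (rightmostStatuses p n).length + i :=
      ⟨m - (rightmostStatuses p n).length, by omega⟩
    subst hi
    rw [Nat.add_sub_cancel_left, rightmostBlock]
    rcases Nat.lt_or_ge i (numSons p s - 1) with h | h
    · rw [List.getD_append _ _ _ _ (by simpa using h)]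
      simp only [List.getD_eq_getElem?_getD, List.getElem?_replicate, h, if_true, Option.getD_some,
        reduceCtorEq, false_iff]
      omega
    · have : i = numSons p s - 1 := by omega
      subst this
      simp only [List.getD_eq_getElem?_getD, List.getElem?_append_right, List.length_replicate,
        le_refl, Nat.sub_self, List.getElem?_cons_zero, Option.getD_some, true_iff]
      omega

/-- The tree equipped with `rightmost` is the one in which the black son of each node is its last
son. -/
theorem rightmost_blackPos (p : ℕ) (hp : 5 ≤ p) (ν : ℕ+) :
    (rightmost p hp).blackPos ν = numSons p ((rightmost p hp).status ν) := rfl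

end MetallicTree

/-! Write S(n) for `shift p n`, the number with code [n]0. Splitting off the last digit writes every
m > 0 as S(n) + h with h admissible after [n]. The recurrence for the metallic numbers gives S(m) +
n = (p - 2) m. Hence S grows by p - 2 from m to m + 1 when only the last digit is raised, and by p -
3 when there is a carry, that is, when [m + 1] ends in 0 (`shift_succ_and_signature`).

These increments are the numbers of sons of a white and of a black node. So if the black nodes other
than the root are exactly those of signature 0, the sons of ν ≠ 1 fill the interval from S(ν - 1) +
1 to S(ν): they are [ν-1]1, [ν-1]2, … and finally [ν]0, the only one of signature 0. Making the last
son black reproduces this condition on the next nodes, and the induction closes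
(`leftmost_and_status`). The root is black with signature 1, but its sons begin at 2 instead of S(0)
+ 1 = 1, which makes up for the missing son.

Conversely, if [ν]0 is always a son of ν, then a node of nonzero signature other than the root
cannot be black: it would have one son too few to reach [ν]0. The black son of each node is then
forced to be the one of signature 0, which is the last (`eq_rightmost`). -/

namespace MetallicTree

/-! ### Words read from the least significant digit -/

/-- The word ends, at its least significant end, with `d c … c`. -/
def ForbidsMax (p : ℕ) : List ℕ → Prop
  | [] => False
  | a :: w => a = p - 3 ∨ (a = p - 4 ∧ ForbidsMax p w)

/-- Links the recursive form, suited to tracking carries, with the quantified pattern in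
`HasForbiddenPattern`. -/
theorem forbidsMax_iff {p : ℕ} (w : List ℕ) :
    ForbidsMax p w ↔ ∃ j, (List.replicate j (p - 4) ++ [p - 3]) <+: w := by
  induction w with
  | nil => simp [ForbidsMax]
  | cons a w ih =>
    rw [ForbidsMax, ih]
    constructor
    · rintro (rfl | ⟨rfl, j, hj⟩)
      · exact ⟨0, by simp⟩
      · exact ⟨j + 1, by simpa [List.replicate_succ, List.cons_prefix_cons] using hj⟩
    · rintro ⟨j, hj⟩
      cases j with
      | zero =>
        simp only [List.replicate_zero, List.nil_append, List.cons_prefix_cons] at hj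
        exact Or.inl hj.1.symm
      | succ j =>
        rw [List.replicate_succ, List.cons_append, List.cons_prefix_cons] at hj
        exact Or.inr ⟨hj.1.symm, j, hj.2⟩

theorem hasForbiddenPattern_cons {p : ℕ} (a : ℕ) (w : List ℕ) :
    HasForbiddenPattern p (a :: w) ↔
      HasForbiddenPattern p w ∨ (a = p - 3 ∧ ForbidsMax p w) := by
  rw [forbidsMax_iff]
  simp only [HasForbiddenPattern, List.infix_cons_iff, List.cons_prefix_cons, exists_or]
  rw [or_comm, exists_and_left, eq_comm]

theorem wordValue_cons (p a : ℕ) (w : List ℕ) :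
    wordValue p (a :: w) = a + wordValue p (0 :: w) := by
  simp [wordValue, Fin.sum_univ_succ, metallicNumber]

/-- The recurrence of the metallic numbers, summed over the digits. -/
theorem wordValue_zero_zero_cons {p : ℕ} (hp : 5 ≤ p) (w : List ℕ) :
    wordValue p (0 :: 0 :: w) + wordValue p w = (p - 2) * wordValue p (0 :: w) := by
  have e0 : wordValue p (0 :: w) = ∑ i : Fin w.length, w.get i * metallicNumber p (i + 1) := by
    simp [wordValue, Fin.sum_univ_succ]
  have e1 : wordValue p (0 :: 0 :: w) =
      ∑ i : Fin w.length, w.get i * metallicNumber p (i + 2) := by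
    simp [wordValue, Fin.sum_univ_succ]
  rw [e0, e1, wordValue, ← Finset.sum_add_distrib, Finset.mul_sum]
  refine Finset.sum_congr rfl fun i _ => ?_
  rw [← mul_add, metallicNumber_add hp, mul_left_comm]

/-- Holds digit by digit, as each metallic number is at least twice the preceding one. This growth
makes the descent from n to [n] without its last digit well-founded. -/
theorem two_mul_wordValue_le {p : ℕ} (hp : 5 ≤ p) (w : List ℕ) :
    2 * wordValue p w ≤ wordValue p (0 :: w) := by
  have e0 : wordValue p (0 :: w) = ∑ i : Fin w.length, w.get i * metallicNumber p (i + 1) := by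
    simp [wordValue, Fin.sum_univ_succ]
  rw [e0, wordValue, Finset.mul_sum]
  refine Finset.sum_le_sum fun i _ => ?_
  rw [mul_left_comm]
  obtain ⟨h1, h2⟩ := prevNumber_lt_and_add hp i
  have h3 : 3 * metallicNumber p i ≤ (p - 2) * metallicNumber p i :=
    Nat.mul_le_mul_right _ (by omega)
  exact Nat.mul_le_mul_left _ (by omega)

/-! ### Appending and removing a last digit -/

/-- The number whose metallic code is `[n]0`. -/
noncomputable def shift (p n : ℕ) : ℕ := wordValue p (0 :: metallicCode p n)

/-- The digit `h` may be written to the right of `[n]`. -/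
def CanAppend (p n h : ℕ) : Prop :=
  h ≤ p - 3 ∧ (h = p - 3 → ¬ ForbidsMax p (metallicCode p n))

theorem isMetallicCode_metallicCode {p : ℕ} (hp : 5 ≤ p) (n : ℕ) :
    IsMetallicCode p (metallicCode p n) n := (isMetallicCode_iff hp _ _).2 rfl

theorem metallicCode_zero {p : ℕ} (hp : 5 ≤ p) : metallicCode p 0 = [] := by
  rw [← isMetallicCode_iff hp]
  exact ⟨by simp, by simp, by simp [HasForbiddenPattern], by simp [wordValue]⟩

theorem metallicCode_ne_nil {p n : ℕ} (hp : 5 ≤ p) (hn : n ≠ 0) : metallicCode p n ≠ [] := by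
  intro h
  rw [← (isMetallicCode_metallicCode hp n).value_eq, h] at hn
  simp [wordValue] at hn

theorem two_mul_le_shift {p : ℕ} (hp : 5 ≤ p) (n : ℕ) : 2 * n ≤ shift p n := by
  have h := two_mul_wordValue_le hp (metallicCode p n)
  rwa [(isMetallicCode_metallicCode hp n).value_eq] at h

theorem shift_zero {p : ℕ} (hp : 5 ≤ p) : shift p 0 = 0 := by
  simp [shift, metallicCode_zero hp, wordValue]

theorem metallicCode_shift_add {p n h : ℕ} (hp : 5 ≤ p) (hh : CanAppend p n h)
    (h0 : n ≠ 0 ∨ h ≠ 0) : metallicCode p (shift p n + h) = h :: metallicCode p n := by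
  have hn := isMetallicCode_metallicCode hp n
  rw [← isMetallicCode_iff hp]
  refine ⟨?_, ?_, ?_, ?_⟩
  · simpa using ⟨hh.1, hn.digit_le⟩
  · by_cases h1 : n = 0
    · subst h1
      simpa [metallicCode_zero hp] using h0
    · rw [List.getLast?_cons_of_ne_nil (metallicCode_ne_nil hp h1)]
      exact hn.leading_ne_zero
  · rw [hasForbiddenPattern_cons]
    rintro (h1 | ⟨h1, h2⟩)
    · exact hn.not_forbidden h1
    · exact hh.2 h1 h2
  · rw [wordValue_cons, add_comm, shift]

/-- Removing the last digit of a code leaves a code. The nonvanishing clause rules out the word 0,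
whose leading digit is 0. -/
theorem exists_eq_shift_add {p m : ℕ} (hp : 5 ≤ p) (hm : m ≠ 0) :
    ∃ n h, CanAppend p n h ∧ (n ≠ 0 ∨ h ≠ 0) ∧ m = shift p n + h := by
  obtain ⟨h, w, hw⟩ := List.exists_cons_of_ne_nil (metallicCode_ne_nil hp hm)
  have hc := isMetallicCode_metallicCode hp m
  rw [hw] at hc
  have h1 := hc.not_forbidden
  rw [hasForbiddenPattern_cons, not_or, not_and] at h1
  have hwc : metallicCode p (wordValue p w) = w := by
    rw [← isMetallicCode_iff hp]
    refine ⟨fun a ha => hc.digit_le a (by simp [ha]), fun h2 => ?_, h1.1, rfl⟩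
    have h3 : w ≠ [] := by rintro rfl; simp at h2
    exact hc.leading_ne_zero (by rw [List.getLast?_cons_of_ne_nil h3, h2])
  refine ⟨wordValue p w, h, ⟨hc.digit_le h (by simp), ?_⟩, ?_, ?_⟩
  · rw [hwc]; exact h1.2
  · rcases eq_or_ne w [] with rfl | h3
    · right
      rintro rfl
      exact hc.leading_ne_zero (by simp)
    · left
      intro h4
      rw [h4, metallicCode_zero hp] at hwc
      exact h3 hwc.symm
  · rw [← hc.value_eq, wordValue_cons, shift, hwc, add_comm]

theorem shift_shift_add {p n h : ℕ} (hp : 5 ≤ p) (hh : CanAppend p n h) (h0 : n ≠ 0 ∨ h ≠ 0) :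
    shift p (shift p n + h) + n = (p - 2) * (shift p n + h) := by
  have h1 := wordValue_zero_zero_cons hp (metallicCode p n)
  have h2 : wordValue p (0 :: h :: metallicCode p n) =
      h * (p - 2) + wordValue p (0 :: 0 :: metallicCode p n) := by
    simp [wordValue, Fin.sum_univ_succ, metallicNumber]
  rw [shift, metallicCode_shift_add hp hh h0, h2, mul_add, shift, ← h1,
    (isMetallicCode_metallicCode hp n).value_eq]
  ring

/-! ### Gaps of the shift and carries -/

/-- Between `[n]0` and `[n+1]0` come all the numbers `[n]h`; moreover `[n+1]` ends with `0` exactly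
when the digit `d` may not be appended to `[n]`. -/
theorem shift_succ_and_signature {p : ℕ} (hp : 5 ≤ p) (n : ℕ) :
    (ForbidsMax p (metallicCode p n) →
      shift p (n + 1) = shift p n + (p - 3) ∧ signature p (n + 1) = 0) ∧
    (¬ ForbidsMax p (metallicCode p n) →
      shift p (n + 1) = shift p n + (p - 2) ∧ signature p (n + 1) ≠ 0) := by
  induction n using Nat.strong_induction_on with
  | _ n ih =>
  -- Raising the last digit keeps the prefix m, so the relations S(n) + m = (p - 2) n and S(n + 1) +
  -- m = (p - 2)(n + 1) can be subtracted. The alternative n = 0 admits m = h = 0, the empty code.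
  have incr : ∀ m h, n = shift p m + h → CanAppend p m h → (m ≠ 0 ∨ h ≠ 0 ∨ n = 0) →
      CanAppend p m (h + 1) → shift p (n + 1) = shift p n + (p - 2) ∧ signature p (n + 1) ≠ 0 := by
    intro m h e c1 c2 c3
    have e1 : shift p n + m = (p - 2) * n := by
      by_cases h0 : m ≠ 0 ∨ h ≠ 0
      · rw [e]; exact shift_shift_add hp c1 h0
      · push Not at h0
        obtain ⟨rfl, rfl⟩ := h0
        rw [shift_zero hp] at e
        simp [e, shift_zero hp]
    have e2 := shift_shift_add hp c3 (Or.inr (Nat.succ_ne_zero h))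
    rw [← add_assoc, ← e, mul_add, mul_one] at e2
    refine ⟨by omega, ?_⟩
    rw [signature, e, add_assoc, metallicCode_shift_add hp c3 (Or.inr (Nat.succ_ne_zero h))]
    simp
  rcases Nat.eq_zero_or_pos n with h0 | h0
  · have hf : ¬ ForbidsMax p (metallicCode p 0) := by simp [metallicCode_zero hp, ForbidsMax]
    have := incr 0 0 (by simp [h0, shift_zero hp]) ⟨by omega, by omega⟩ (by simp [h0])
      ⟨by omega, fun _ => hf⟩
    rw [h0] at this ⊢
    exact ⟨fun h => absurd h hf, fun _ => this⟩
  · obtain ⟨m, h, c1, c2, e⟩ := exists_eq_shift_add hp h0.ne'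
    have hc : metallicCode p n = h :: metallicCode p m := by rw [e, metallicCode_shift_add hp c1 c2]
    have e1 : shift p n + m = (p - 2) * n := by rw [e]; exact shift_shift_add hp c1 c2
    rw [hc, ForbidsMax]
    constructor
    · intro hf
      have hm : m < n := by
        have := two_mul_le_shift hp m
        omega
      -- A carry: h is the largest digit allowed after [m], so by induction n + 1 is the next value
      -- of the shift. The prefix grows to m + 1, which costs one unit in the increment.
      have e2 : n + 1 = shift p (m + 1) := by
        rcases hf with rfl | ⟨rfl, hf⟩
        · have := ((ih m hm).2 (c1.2 rfl)).1
          omega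
        · have := ((ih m hm).1 hf).1
          omega
      have c3 : CanAppend p (m + 1) 0 := ⟨by omega, by omega⟩
      have e3 := shift_shift_add hp c3 (Or.inl (Nat.succ_ne_zero m))
      rw [add_zero, ← e2, mul_add] at e3
      refine ⟨by omega, ?_⟩
      rw [signature, e2, ← add_zero (shift p (m + 1)),
        metallicCode_shift_add hp c3 (Or.inl (Nat.succ_ne_zero m))]
      rfl
    · intro hf
      push Not at hf
      have := c1.1
      refine incr m h e c1 (by tauto) ⟨by omega, fun h1 => hf.2 (by omega)⟩


theorem canAppend_iff {p n h : ℕ} (hp : 5 ≤ p) :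
    CanAppend p n h ↔ shift p n + h < shift p (n + 1) := by
  have h1 := shift_succ_and_signature hp n
  by_cases hf : ForbidsMax p (metallicCode p n)
  · rw [(h1.1 hf).1, CanAppend]
    constructor
    · rintro ⟨h2, h3⟩
      have : h ≠ p - 3 := fun h4 => h3 h4 hf
      omega
    · intro h2
      exact ⟨by omega, by omega⟩
  · rw [(h1.2 hf).1, CanAppend]
    constructor
    · rintro ⟨h2, -⟩
      omega
    · intro h2
      exact ⟨by omega, fun _ => hf⟩

theorem shift_succ {p : ℕ} (hp : 5 ≤ p) (n : ℕ) :
    shift p (n + 1) = shift p n + if signature p (n + 1) = 0 then p - 3 else p - 2 := by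
  have h1 := shift_succ_and_signature hp n
  by_cases hf : ForbidsMax p (metallicCode p n)
  · rw [if_pos (h1.1 hf).2, (h1.1 hf).1]
  · rw [if_neg (h1.2 hf).2, (h1.2 hf).1]

theorem metallicCode_shift {p n : ℕ} (hp : 5 ≤ p) (hn : n ≠ 0) :
    metallicCode p (shift p n) = 0 :: metallicCode p n :=
  metallicCode_shift_add (h := 0) hp ⟨by omega, by omega⟩ (Or.inl hn)

theorem signature_shift_add {p n h : ℕ} (hp : 5 ≤ p) (hh : CanAppend p n h)
    (h0 : n ≠ 0 ∨ h ≠ 0) : signature p (shift p n + h) = h := by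
  rw [signature, metallicCode_shift_add hp hh h0]
  rfl

theorem shift_one {p : ℕ} (hp : 5 ≤ p) : shift p 1 = p - 2 := by
  have := ((shift_succ_and_signature hp 0).2 (by simp [metallicCode_zero hp, ForbidsMax])).1
  simpa [shift_zero hp] using this

theorem metallicCode_of_le {p h : ℕ} (hp : 5 ≤ p) (h0 : h ≠ 0) (hh : h ≤ p - 3) :
    metallicCode p h = [h] := by
  have := metallicCode_shift_add (n := 0) hp
    ⟨hh, by simp [metallicCode_zero hp, ForbidsMax]⟩ (Or.inr h0)
  simpa [shift_zero hp, metallicCode_zero hp] using this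

theorem signature_one {p : ℕ} (hp : 5 ≤ p) : signature p 1 = 1 := by
  rw [signature, metallicCode_of_le hp one_ne_zero (by omega)]
  rfl

/-! ### Positions and statuses of the nodes -/

namespace BlackAssignment

variable {p : ℕ}

/-- One strong induction serves both purposes: the second alternative describes `rightmost`, the
first is all that uniqueness needs. They differ only in why a node of nonzero signature is white. -/
theorem leftmost_and_status (hp : 5 ≤ p) (α : BlackAssignment p)
    (h : (∀ ν : ℕ+, shift p ν < α.leftmost (ν + 1)) ∨
      ∀ ν, α.blackPos ν = numSons p (α.status ν)) (ν : ℕ+) :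
    (α.leftmost (ν + 1) : ℕ) = shift p ν + 1 ∧
      (α.status ν = .black ↔ ν = 1 ∨ signature p ν = 0) := by
  induction ν using PNat.strongInductionOn with
  | _ ν ih =>
  rcases eq_or_ne ν 1 with rfl | hν
  · rw [α.leftmost_succ, α.leftmost_root, α.status_root]
    simp only [PNat.val_ofNat, shift_one hp, numSons, true_or, and_true]
    omega
  -- Node k + 1 is indexed by its predecessor k. At k = 0 only the inequality holds, the root's
  -- first son being 2; the bound 2 keeps the root from being anyone's son.
  have left : ∀ k : ℕ, k < ν → shift p k + 1 ≤ α.leftmost k.succPNat ∧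
      (k ≠ 0 → (α.leftmost k.succPNat : ℕ) = shift p k + 1) ∧ 2 ≤ (α.leftmost k.succPNat : ℕ) := by
    intro k hk
    rcases Nat.eq_zero_or_pos k with rfl | h0
    · rw [show Nat.succPNat 0 = 1 from rfl, α.leftmost_root]
      simp [shift_zero hp]
    · obtain ⟨κ, rfl⟩ : ∃ κ : ℕ+, (κ : ℕ) = k := ⟨k.toPNat h0, rfl⟩
      have h1 := (ih κ hk).1
      rw [show κ + 1 = (κ : ℕ).succPNat from rfl] at h1
      rw [h1]
      simp only [le_refl, implies_true, true_and]
      have := two_mul_le_shift hp κ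
      have := κ.pos
      omega
  obtain ⟨l, hl⟩ : ∃ l, (ν : ℕ) = l + 1 := ⟨ν - 1, by have := ν.pos; omega⟩
  have hl0 : l ≠ 0 := by
    rintro rfl
    exact hν (PNat.eq hl)
  have hνl : ν = l.succPNat := PNat.eq hl
  have hleft : (α.leftmost ν : ℕ) = shift p l + 1 := by
    rw [hνl]
    exact (left l (by omega)).2.1 hl0
  have hstatus : α.status ν = .black ↔ signature p ν = 0 := by
    obtain ⟨k, a, c1, c2, e⟩ := exists_eq_shift_add hp ν.ne_zero
    have hk2 := two_mul_le_shift hp k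
    rw [e, signature_shift_add hp c1 c2]
    rcases Nat.eq_zero_or_pos a with rfl | ha
    · simp only [iff_true]
      obtain ⟨q, rfl⟩ : ∃ q, k = q + 1 := ⟨k - 1, by omega⟩
      have hq := left q (by omega)
      have hq1 := (left (q + 1) (by omega)).2.1 (by omega)
      have hb1 := α.one_le_blackPos q.succPNat
      have hb2 := α.blackPos_le q.succPNat
      have hs := α.leftmost_succ q.succPNat
      rw [show q.succPNat + 1 = (q + 1).succPNat from rfl] at hs
      obtain ⟨σ, hσ⟩ : ∃ σ : ℕ+, (σ : ℕ) + 1 = α.leftmost q.succPNat + α.blackPos q.succPNat :=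
        ⟨⟨α.leftmost q.succPNat + α.blackPos q.succPNat - 1, by omega⟩, by
          simp only [PNat.mk_coe]; omega⟩
      have hσb : α.status σ = .black := by
        refine (α.status_son q.succPNat σ (by omega) ?_).2 hσ
        rw [show q.succPNat + 1 = (q + 1).succPNat from rfl]
        omega
      -- Here ν is [k]0, the last son of k = q + 1, and σ is the black son of k. If σ came earlier,
      -- induction would give it signature 0, yet σ is [q]b with b > 0.
      rcases eq_or_ne σ ν with rfl | hne
      · exact hσb
      have hlt : σ < ν := lt_of_le_of_ne (PNat.coe_le_coe _ _ |>.1 (by omega)) hne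
      have hlt' : (σ : ℕ) < ν := hlt
      rcases (ih σ hlt).2.1 hσb with rfl | h0
      · simp at hσ
        omega
      · obtain ⟨b, hb⟩ : ∃ b, (σ : ℕ) = shift p q + b := ⟨σ - shift p q, by omega⟩
        rw [hb, signature_shift_add hp ((canAppend_iff hp).2 (by omega)) (by omega)] at h0
        omega
    · rcases h with h | h
      · have hν1 := h ν
        rw [α.leftmost_succ, hleft, hl, shift_succ hp, if_neg] at hν1
        · cases hst : α.status ν
          · rw [hst, numSons] at hν1
            omega
          · simp [ha.ne']
        · rw [← hl, e, signature_shift_add hp c1 c2]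
          exact ha.ne'
      · have c3 := (canAppend_iff hp).1 c1
        have hkν : k + 1 < ν := by
          by_contra hlt
          have hk0 : k = 0 := by omega
          rw [hk0, shift_zero hp] at e
          omega
        have hk := left k (by omega)
        have hk1 := (left (k + 1) hkν).2.1 (by omega)
        rw [α.status_son k.succPNat ν, h, ← α.leftmost_succ,
          show k.succPNat + 1 = (k + 1).succPNat from rfl, hk1]
        · omega
        · rcases Nat.eq_zero_or_pos k with rfl | h0
          · rw [show Nat.succPNat 0 = 1 from rfl, α.leftmost_root]
            simp; omega
          · have := hk.2.1 h0.ne'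
            omega
        · rw [show k.succPNat + 1 = (k + 1).succPNat from rfl, hk1]
          omega
  refine ⟨?_, by simp [hstatus, hν]⟩
  rw [α.leftmost_succ, hleft, hl, shift_succ hp, ← hl]
  by_cases h0 : signature p ν = 0
  · rw [hstatus.2 h0, if_pos h0, numSons]
    omega
  · have : α.status ν = .white := by
      cases hst : α.status ν
      · exact absurd (hstatus.1 hst) h0
      · rfl
    rw [this, if_neg h0, numSons]
    omega

theorem mem_sons_iff (α : BlackAssignment p) (ν σ : ℕ+) :
    σ ∈ α.sons ν ↔ (α.leftmost ν : ℕ) ≤ σ ∧ (σ : ℕ) < α.leftmost (ν + 1) := by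
  rw [α.leftmost_succ]
  simp only [sons, List.mem_map, List.mem_range]
  constructor
  · rintro ⟨i, hi, rfl⟩
    simp [Nat.toPNat, hi]
  · rintro ⟨h1, h2⟩
    exact ⟨σ - α.leftmost ν, by omega, PNat.eq (by simp [Nat.toPNat]; omega)⟩

theorem eq_rightmost (hp : 5 ≤ p) (α : BlackAssignment p)
    (h : ∀ ν : ℕ+, shift p ν < α.leftmost (ν + 1)) : α = rightmost p hp := by
  have h1 := leftmost_and_status hp α (Or.inl h)
  have h2 := leftmost_and_status hp (rightmost p hp) (Or.inr (rightmost_blackPos p hp))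
  have hleft : α.leftmost = (rightmost p hp).leftmost := by
    funext ν
    induction ν using PNat.recOn with
    | one => rw [leftmost_root, leftmost_root]
    | succ ν _ => exact PNat.eq ((h1 ν).1.trans (h2 ν).1.symm)
  have hstatus : α.status = (rightmost p hp).status := by
    funext ν
    have := (h1 ν).2.trans (h2 ν).2.symm
    cases hs : α.status ν <;> cases ht : (rightmost p hp).status ν <;> simp_all
  refine BlackAssignment.ext hleft ?_ hstatus
  funext ν
  -- The black position is recovered from the black son itself, whose status is the same in both
  -- assignments.
  obtain ⟨σ, hσ⟩ : ∃ σ : ℕ+, (σ : ℕ) + 1 = α.leftmost ν + α.blackPos ν :=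
    ⟨⟨α.leftmost ν + α.blackPos ν - 1, by
      have := α.one_le_blackPos ν; have := (α.leftmost ν).pos; omega⟩, by
      have := α.one_le_blackPos ν
      simp only [PNat.mk_coe]; omega⟩
  have h3 : (α.leftmost ν : ℕ) ≤ σ := by have := α.one_le_blackPos ν; omega
  have h4 : (σ : ℕ) < α.leftmost (ν + 1) := by
    have := α.blackPos_le ν
    have := α.leftmost_succ ν
    omega
  have h5 := (α.status_son ν σ h3 h4).2 hσ
  rw [hstatus] at h5
  rw [hleft] at h3 h4
  have h6 := ((rightmost p hp).status_son ν σ h3 h4).1 h5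
  rw [← hleft] at h6
  omega

/-! ### Types and codes of the sons under the rightmost assignment -/

/-- The last son of `ν` in the rightmost assignment is `[ν]0`. -/
theorem leftmost_succ_rightmost (hp : 5 ≤ p) (ν : ℕ+) :
    ((rightmost p hp).leftmost (ν + 1) : ℕ) = shift p ν + 1 :=
  (leftmost_and_status hp _ (Or.inr (rightmost_blackPos p hp)) ν).1

theorem status_rightmost (hp : 5 ≤ p) (ν : ℕ+) :
    (rightmost p hp).status ν = .black ↔ ν = 1 ∨ signature p ν = 0 :=
  (leftmost_and_status hp _ (Or.inr (rightmost_blackPos p hp)) ν).2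

theorem leftmost_rightmost (hp : 5 ≤ p) {ν : ℕ+} (hν : ν ≠ 1) :
    ((rightmost p hp).leftmost ν : ℕ) = shift p (ν - 1) + 1 := by
  obtain ⟨k, rfl⟩ := PNat.exists_eq_succ_of_ne_one hν
  simpa using leftmost_succ_rightmost hp k

theorem status_rightmost_eq_white (hp : 5 ≤ p) {ν : ℕ+} (h1 : ν ≠ 1) (h2 : signature p ν ≠ 0) :
    (rightmost p hp).status ν = .white := by
  have := status_rightmost hp ν
  cases hs : (rightmost p hp).status ν
  · simp_all
  · rfl

/-- The sons of `ν` in the rightmost assignment are `s + r`, `s + r + 1`, …, `[ν]0`. -/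
theorem map_sons_rightmost {β : Type*} (hp : 5 ≤ p) (ν : ℕ+) (f : ℕ+ → β) (g : ℕ → β) (b : β)
    (r s : ℕ) (hr : s + r = (rightmost p hp).leftmost ν)
    (hg : ∀ (h : ℕ) (σ : ℕ+), r ≤ h → (σ : ℕ) = s + h → (σ : ℕ) < shift p ν → f σ = g h)
    (hb : ∀ σ : ℕ+, (σ : ℕ) = shift p ν → f σ = b) :
    ((rightmost p hp).sons ν).map f =
      (List.range' r (numSons p ((rightmost p hp).status ν) - 1)).map g ++ [b] := by
  have h1 := leftmost_succ_rightmost hp ν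
  rw [leftmost_succ] at h1
  obtain ⟨N, hN⟩ : ∃ N, numSons p ((rightmost p hp).status ν) = N + 1 := by
    cases (rightmost p hp).status ν
    · exact ⟨p - 4, by simp only [numSons]; omega⟩
    · exact ⟨p - 3, by simp only [numSons]; omega⟩
  rw [sons, hN, List.range_succ, List.map_append, List.map_append, Nat.add_sub_cancel,
    List.range'_eq_map_range, List.map_map, List.map_map, List.map_map]
  congr 1
  · refine List.map_congr_left fun i hi => ?_
    rw [List.mem_range] at hi
    refine hg _ _ (Nat.le_add_right r i) ?_ ?_ <;> simp only [Nat.toPNat, PNat.mk_coe] <;> omega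
  · simp only [List.map_cons, List.map_nil, List.cons.injEq, and_true]
    refine hb _ ?_
    simp only [Nat.toPNat, PNat.mk_coe]; omega

theorem nodeType_rightmost_shift (hp : 5 ≤ p) {ν σ : ℕ+} (h : (σ : ℕ) = shift p ν) :
    (rightmost p hp).nodeType σ = (.black, 0) := by
  have hs : signature p σ = 0 := by
    rw [signature, h, metallicCode_shift hp ν.ne_zero]
    rfl
  rw [nodeType, hs, (status_rightmost hp σ).2 (Or.inr hs)]

theorem nodeType_rightmost_of_signature (hp : 5 ≤ p) {σ : ℕ+} {h : ℕ} (h1 : σ ≠ 1) (h0 : h ≠ 0)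
    (hs : signature p σ = h) : (rightmost p hp).nodeType σ = (.white, h) := by
  rw [nodeType, status_rightmost_eq_white hp h1 (by rwa [hs]), hs]

/-- All sons except the last, [ν]0, have nonzero signature. The predicate P allows for both
readings, signature 0 and code [ν]0. -/
theorem existsUnique_son_rightmost (hp : 5 ≤ p) (ν : ℕ+) (P : ℕ → Prop) (hP : P (shift p ν))
    (h : ∀ m, P m → signature p m = 0) :
    ∃! σ : ℕ+, σ ∈ (rightmost p hp).sons ν ∧ P σ := by
  have h1 := leftmost_succ_rightmost hp ν
  have h2 := two_mul_le_shift hp ν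
  have h3 := ν.pos
  have h4 := (rightmost p hp).leftmost_succ ν
  obtain ⟨τ, hτ⟩ : ∃ τ : ℕ+, (τ : ℕ) = shift p ν := ⟨(shift p ν).toPNat (by omega), rfl⟩
  refine ⟨τ, ⟨?_, by rwa [hτ]⟩, ?_⟩
  · rw [mem_sons_iff, hτ]
    refine ⟨?_, by omega⟩
    cases hs : (rightmost p hp).status ν <;> rw [hs, numSons] at h4 <;> omega
  · rintro σ ⟨hσ, hσP⟩
    rw [mem_sons_iff] at hσ
    refine PNat.eq ?_
    rw [hτ]
    by_contra hne
    have h5 := h _ hσP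
    rcases eq_or_ne ν 1 with rfl | hν
    · rw [leftmost_root] at hσ
      simp only [PNat.val_ofNat, shift_one hp] at *
      rw [signature, metallicCode_of_le hp σ.ne_zero (by omega)] at h5
      exact σ.ne_zero h5
    · rw [leftmost_rightmost hp hν] at hσ
      obtain ⟨b, hb⟩ : ∃ b, (σ : ℕ) = shift p (ν - 1) + b := ⟨σ - shift p (ν - 1), by omega⟩
      rw [hb, signature_shift_add hp ((canAppend_iff hp).2 ?_) (by omega)] at h5
      · omega
      · rw [Nat.sub_add_cancel h3]
        omega

theorem map_sons_rightmost_of_ne_one (hp : 5 ≤ p) {ν : ℕ+} (hν : ν ≠ 1) :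
    ((rightmost p hp).sons ν).map (rightmost p hp).nodeType =
        (List.range' 1 (numSons p ((rightmost p hp).status ν) - 1)).map
          (fun a => (Status.white, a)) ++ [(Status.black, 0)] ∧
      ((rightmost p hp).sons ν).map (fun σ : ℕ+ => metallicCode p (σ : ℕ)) =
        (List.range' 1 (numSons p ((rightmost p hp).status ν) - 1)).map
          (fun h => h :: metallicCode p (ν - 1)) ++ [0 :: metallicCode p ν] := by
  have hl := leftmost_rightmost hp hν
  have key : ∀ (h : ℕ) (σ : ℕ+), 1 ≤ h → (σ : ℕ) = shift p (ν - 1) + h → (σ : ℕ) < shift p ν →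
      CanAppend p (ν - 1) h := by
    intro h σ h1 h2 h3
    rw [canAppend_iff hp, Nat.sub_add_cancel ν.pos]
    omega
  constructor
  · refine map_sons_rightmost hp ν _ _ _ 1 (shift p (ν - 1)) hl.symm ?_
      fun σ hσ => nodeType_rightmost_shift hp hσ
    intro h σ h1 h2 h3
    refine nodeType_rightmost_of_signature hp ?_ (by omega) ?_
    · rintro rfl
      have h4 : (ν : ℕ) ≠ 1 := fun h5 => hν (PNat.eq h5)
      have := two_mul_le_shift hp (ν - 1)
      have := ν.pos
      simp at h2
      omega
    · rw [h2, signature_shift_add hp (key h σ h1 h2 h3) (by omega)]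
  · refine map_sons_rightmost hp ν _ _ _ 1 (shift p (ν - 1)) hl.symm ?_ ?_
    · intro h σ h1 h2 h3
      rw [h2, metallicCode_shift_add hp (key h σ h1 h2 h3) (by omega)]
    · intro σ hσ
      rw [hσ, metallicCode_shift hp ν.ne_zero]

theorem map_sons_rightmost_one (hp : 5 ≤ p) :
    ((rightmost p hp).sons 1).map (rightmost p hp).nodeType =
        (List.range' 2 (p - 4)).map (fun a => (Status.white, a)) ++ [(Status.black, 0)] ∧
      ((rightmost p hp).sons 1).map (fun σ : ℕ+ => metallicCode p (σ : ℕ)) =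
        (List.range' 2 (p - 4)).map (fun h => [h]) ++ [[0, 1]] := by
  have hn : p - 4 = numSons p ((rightmost p hp).status 1) - 1 := by
    rw [status_root, numSons]
    omega
  have key : ∀ (h : ℕ) (σ : ℕ+), 2 ≤ h → (σ : ℕ) = 0 + h → (σ : ℕ) < shift p (1 : ℕ+) →
      metallicCode p σ = [h] := by
    intro h σ h1 h2 h3
    rw [PNat.val_ofNat, shift_one hp] at h3
    rw [metallicCode_of_le hp σ.ne_zero (by omega), h2, zero_add]
  rw [hn]
  constructor
  -- The root's sons start at 0 + 2, so the digit 1 is skipped; other nodes use the offset S(ν - 1)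
  -- and start at digit 1.
  · refine map_sons_rightmost hp 1 _ _ _ 2 0 rfl ?_ fun σ hσ => nodeType_rightmost_shift hp hσ
    intro h σ h1 h2 h3
    refine nodeType_rightmost_of_signature hp ?_ (by omega) ?_
    · rintro rfl
      simp at h2
      omega
    · rw [signature, key h σ h1 h2 h3]
      rfl
  · refine map_sons_rightmost hp 1 _ _ _ 2 0 rfl key ?_
    intro σ hσ
    rw [hσ, metallicCode_shift hp (PNat.ne_zero 1), PNat.val_ofNat,
      metallicCode_of_le hp one_ne_zero (by omega)]

end BlackAssignment

end MetallicTree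

/-! ### The main theorem -/

open MetallicTree in
theorem mainTheorem3 (p : ℕ) (hp : 5 ≤ p) :
    -- the root: rule `b1 → w2 … wd b0`, codes of its sons `2, …, d, 10`
    -- (words are lists of digits with the least significant digit first)
    ((rightmost p hp).nodeType 1 = (.black, 1) ∧
      ((rightmost p hp).sons 1).map (rightmost p hp).nodeType =
        (List.range' 2 (p - 4)).map (fun a => (Status.white, a)) ++ [(Status.black, 0)] ∧
      ((rightmost p hp).sons 1).map (fun σ : ℕ+ => metallicCode p (σ : ℕ)) =
        (List.range' 2 (p - 4)).map (fun h => [h]) ++ [[0, 1]]) ∧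
    -- the other nodes: rules `b0 → w1 … wc b0` and `wa → w1 … wd b0` with `a > 0`; the codes of
    -- the sons of `ν` are `[ν-1]h` for the white ones and `[ν]0` for the last one
    (∀ ν : ℕ+, ν ≠ 1 →
      ((rightmost p hp).nodeType ν = (.black, 0) ∧
        ((rightmost p hp).sons ν).map (rightmost p hp).nodeType =
          (List.range' 1 (p - 4)).map (fun a => (Status.white, a)) ++ [(Status.black, 0)] ∧
        ((rightmost p hp).sons ν).map (fun σ : ℕ+ => metallicCode p (σ : ℕ)) =
          (List.range' 1 (p - 4)).map (fun h => h :: metallicCode p (ν - 1)) ++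
            [0 :: metallicCode p ν]) ∨
      (∃ a : ℕ, 0 < a ∧ a ≤ p - 3 ∧ (rightmost p hp).nodeType ν = (.white, a) ∧
        ((rightmost p hp).sons ν).map (rightmost p hp).nodeType =
          (List.range' 1 (p - 3)).map (fun a => (Status.white, a)) ++ [(Status.black, 0)] ∧
        ((rightmost p hp).sons ν).map (fun σ : ℕ+ => metallicCode p (σ : ℕ)) =
          (List.range' 1 (p - 3)).map (fun h => h :: metallicCode p (ν - 1)) ++
            [0 :: metallicCode p ν])) ∧
    -- the preferred son property
    (rightmost p hp).IsDigitAssignment 0 ∧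
    (rightmost p hp).HasPreferredSonProperty ∧
    -- no other assignment has it
    (∀ α : BlackAssignment p, α ≠ rightmost p hp → ¬ α.HasPreferredSonProperty) := by
  refine ⟨⟨?_, BlackAssignment.map_sons_rightmost_one hp⟩, ?_, ?_, ?_, ?_⟩
  · rw [BlackAssignment.nodeType, BlackAssignment.status_root, PNat.val_ofNat, signature_one hp]
  · intro ν hν
    have h := BlackAssignment.map_sons_rightmost_of_ne_one hp hν
    by_cases hs : signature p ν = 0
    · have hst := (BlackAssignment.status_rightmost hp ν).2 (Or.inr hs)
      rw [hst, numSons, show p - 3 - 1 = p - 4 by omega] at h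
      exact Or.inl ⟨by rw [BlackAssignment.nodeType, hst, hs], h⟩
    · have hst := BlackAssignment.status_rightmost_eq_white hp hν hs
      rw [hst, numSons, show p - 2 - 1 = p - 3 by omega] at h
      obtain ⟨k, a, c1, c2, e⟩ := exists_eq_shift_add hp ν.ne_zero
      refine Or.inr ⟨signature p ν, by omega, ?_,
        BlackAssignment.nodeType_rightmost_of_signature hp hν hs rfl, h⟩
      rw [e, signature_shift_add hp c1 c2]
      exact c1.1
  · intro ν
    refine BlackAssignment.existsUnique_son_rightmost hp ν (fun m => signature p m = 0) ?_
      fun _ h => h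
    rw [signature, metallicCode_shift hp ν.ne_zero]
    rfl
  · intro ν
    refine BlackAssignment.existsUnique_son_rightmost hp ν
      (fun m => metallicCode p m = 0 :: metallicCode p ν) (metallicCode_shift hp ν.ne_zero) ?_
    intro m hm
    rw [signature, hm]
    rfl
  · intro α hα h
    refine hα (BlackAssignment.eq_rightmost hp α fun ν => ?_)
    -- Only the existence of the son [ν]0 matters: its value is S(ν), so S(ν) lies before the first
    -- son of ν + 1.
    obtain ⟨σ, ⟨h1, h2⟩, -⟩ := h ν
    have h3 := (isMetallicCode_metallicCode hp σ).value_eq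
    rw [h2] at h3
    have h4 := ((BlackAssignment.mem_sons_iff α ν σ).1 h1).2
    rwa [← h3] at h4
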